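/- Graphs are simple. A map $f:V(G)\to V(H)$ is a $c$-quasi-isometric embedding of $G$ into $H$ if $\mathrm{dist}_G(x,y)/c-c\le \mathrm{dist}_H(f(x),f(y))\le c\,\mathrm{dist}_G(x,y)+c$ for all $x,y\in V(G)$ (distances may be $\infty$). It is a $c$-quasi-isometry from $G$ to $H$ if moreover every vertex of $H$ is at distance at most $c$ from some $f(v)$, $v\in V(G)$; $G$ is $c$-quasi-isometric to $H$ if such a map exists. The $n$-subdivision of a graph is obtained by replacing each edge with a path of length exactly $n+1$. Cliquewidth is the least number $k\ge 1$ of colours with which the graph can be built, starting from coloured graphs with at most one vertex, by disjoint unions, by recolouring all vertices of one colour with another colour, and by adding all edges between two distinct colour classes. Theorem. For every real number $c\geq 1$ and every integer $k\geq 6$, there exists a graph $G$ of cliquewidth at most $k$ that is not $c$-quasi-isometric to any graph of treewidth less than $k-3$. Moreover, $G$ can be chosen to be the $n$-subdivision of $K_{k-2}$ for some integer $n\ge 4c(c+1)-1$ such that every graph into which $G$ has a $c$-quasi-isometric embedding contains $K_{k-2}$ as a minor. -/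

import Mathlib

open scoped ENNReal

universe u v

namespace CliquewidthQI

/-! ### Cliquewidth -/

/-- The graph obtained from `G` by adding an edge between each vertex coloured `i` and each
(other) vertex coloured `j`. -/
def joinColours {V : Type u} {k : ℕ} (G : SimpleGraph V) (c : V → Fin k) (i j : Fin k) :
    SimpleGraph V :=
  G ⊔ SimpleGraph.fromRel (fun x y => c x = i ∧ c y = j)

/-- The colouring obtained from `c` by changing the colour of every vertex coloured `i` to `j`. -/
def recolour {V : Type u} {k : ℕ} (c : V → Fin k) (i j : Fin k) : V → Fin k :=
  fun x => if c x = i then j else c x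

/-- `IsCliquewidthPair k G c`: the graph `G` with the colouring `c` (with `k` colours) is a
cliquewidth-`k` pair. The disjoint union is taken up to renaming of the vertices. -/
inductive IsCliquewidthPair (k : ℕ) :
    {V : Type u} → SimpleGraph V → (V → Fin k) → Prop
  | small {V : Type u} [Subsingleton V] (G : SimpleGraph V) (c : V → Fin k) :
      IsCliquewidthPair k G c
  | union {V₁ V₂ V : Type u} [Nonempty V₁] [Nonempty V₂]
      (G₁ : SimpleGraph V₁) (G₂ : SimpleGraph V₂) (G : SimpleGraph V)
      (c₁ : V₁ → Fin k) (c₂ : V₂ → Fin k) (c : V → Fin k)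
      (h₁ : IsCliquewidthPair k G₁ c₁) (h₂ : IsCliquewidthPair k G₂ c₂)
      (e : SimpleGraph.sum G₁ G₂ ≃g G)
      (he₁ : ∀ x : V₁, c (e (Sum.inl x)) = c₁ x) (he₂ : ∀ x : V₂, c (e (Sum.inr x)) = c₂ x) :
      IsCliquewidthPair k G c
  | recolour {V : Type u} (G : SimpleGraph V) (c' : V → Fin k) (i j : Fin k) (hij : i ≠ j)
      (hi : ∃ x, c' x = i) (hj : ∃ x, c' x = j) (h : IsCliquewidthPair k G c') :
      IsCliquewidthPair k G (recolour c' i j)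
  | join {V : Type u} (G' : SimpleGraph V) (c : V → Fin k) (i j : Fin k) (hij : i ≠ j)
      (hproper : G' < joinColours G' c i j) (h : IsCliquewidthPair k G' c) :
      IsCliquewidthPair k (joinColours G' c i j) c

/-- The cliquewidth of a graph: the least `k ≥ 1` such that some colouring with `k` colours makes
the graph a cliquewidth-`k` pair (`⊤` if there is none, as for infinite graphs). -/
noncomputable def cliquewidth {V : Type u} (G : SimpleGraph V) : ℕ∞ :=
  sInf {m : ℕ∞ | ∃ k : ℕ, m = k ∧ 1 ≤ k ∧ ∃ c : V → Fin k, IsCliquewidthPair k G c}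

/-! ### Treewidth -/

/-- A tree decomposition of `G` indexed by the vertices of the graph `T`, which is a tree.
A connected induced subgraph is nonempty by definition. -/
structure TreeDecomposition {V : Type u} (G : SimpleGraph V) {ι : Type v} (T : SimpleGraph ι) where
  isTree : T.IsTree
  bag : ι → Set V
  connected : ∀ x : V, (T.induce {t | x ∈ bag t}).Connected
  edge_mem : ∀ x y : V, G.Adj x y → ∃ t, x ∈ bag t ∧ y ∈ bag t

/-- The width: the maximum size of a bag, minus 1 (`⊤` if the sizes of the bags are unbounded).
The subtraction is truncated, which only matters for the graph without vertices. -/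
noncomputable def TreeDecomposition.width {V : Type u} {G : SimpleGraph V} {ι : Type v}
    {T : SimpleGraph ι} (D : TreeDecomposition G T) : ℕ∞ :=
  (⨆ t, (D.bag t).encard) - 1

/-- The treewidth of a graph: the minimum width of a tree decomposition. -/
noncomputable def treewidth {V : Type u} (G : SimpleGraph V) : ℕ∞ :=
  sInf {m : ℕ∞ | ∃ (ι : Type u) (T : SimpleGraph ι) (D : TreeDecomposition G T), D.width = m}

/-! ### Quasi-isometries -/

/-- `f` is a `c`-quasi-isometric embedding from `G` to `H` (for a positive real number `c`):
`dist_G(x,y)/c - c ≤ dist_H(f x, f y) ≤ c * dist_G(x,y) + c`, where distances may be infinite.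
As distances are nonnegative, it does not matter that the subtraction in `ℝ≥0∞` is truncated. -/
def IsQIEmbedding {V : Type u} {W : Type v} (c : ℝ) (G : SimpleGraph V) (H : SimpleGraph W)
    (f : V → W) : Prop :=
  ∀ x y : V,
    (G.edist x y : ℝ≥0∞) / ENNReal.ofReal c - ENNReal.ofReal c ≤ (H.edist (f x) (f y) : ℝ≥0∞) ∧
    (H.edist (f x) (f y) : ℝ≥0∞) ≤ ENNReal.ofReal c * (G.edist x y : ℝ≥0∞) + ENNReal.ofReal c

/-- `f` is a `c`-quasi-isometry from `G` to `H`. -/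
def IsQuasiIsometry {V : Type u} {W : Type v} (c : ℝ) (G : SimpleGraph V) (H : SimpleGraph W)
    (f : V → W) : Prop :=
  IsQIEmbedding c G H f ∧
    ∀ y : W, ∃ x : V, (H.edist y (f x) : ℝ≥0∞) ≤ ENNReal.ofReal c

/-- `G` is `c`-quasi-isometrically embeddable into `H`. -/
def QIEmbeddable {V : Type u} {W : Type v} (c : ℝ) (G : SimpleGraph V) (H : SimpleGraph W) :
    Prop :=
  ∃ f : V → W, IsQIEmbedding c G H f

/-- `G` is `c`-quasi-isometric to `H`. -/
def QuasiIsometric {V : Type u} {W : Type v} (c : ℝ) (G : SimpleGraph V) (H : SimpleGraph W) :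
    Prop :=
  ∃ f : V → W, IsQuasiIsometry c G H f

/-! ### Minors and subdivisions -/

/-- `H` is a minor of `G`: there are pairwise disjoint (nonempty) connected branch sets in `G`,
one for each vertex of `H`, that are adjacent whenever the vertices of `H` are. -/
def IsMinor {U : Type v} {V : Type u} (H : SimpleGraph U) (G : SimpleGraph V) : Prop :=
  ∃ X : U → Set V,
    (∀ a, (G.induce (X a)).Connected) ∧
    (∀ a b, a ≠ b → Disjoint (X a) (X b)) ∧
    (∀ a b, H.Adj a b → ∃ x ∈ X a, ∃ y ∈ X b, G.Adj x y)

/-- The edges of a graph on a linearly ordered vertex set, each directed from its smaller to its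
larger endpoint. -/
abbrev OrientedEdge {V : Type u} [LinearOrder V] (H : SimpleGraph V) : Type u :=
  {p : V × V // p.1 < p.2 ∧ H.Adj p.1 p.2}

/-- The vertex at position `i`, `0 ≤ i ≤ n + 1`, of the path of length `n + 1` that replaces the
edge `e`. Position `0` is the smaller endpoint of `e` and position `n + 1` is the larger one. -/
def subdivisionPoint {V : Type u} [LinearOrder V] (H : SimpleGraph V) (n : ℕ)
    (e : OrientedEdge H) (i : ℕ) : V ⊕ (OrientedEdge H × Fin n) :=
  if i = 0 then Sum.inl e.1.1
  else if h : i - 1 < n then Sum.inr (e, ⟨i - 1, h⟩)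
  else Sum.inl e.1.2

/-- The `n`-subdivision of `H`: each edge is replaced with a path of length exactly `n + 1`. -/
def subdivision {V : Type u} [LinearOrder V] (H : SimpleGraph V) (n : ℕ) :
    SimpleGraph (V ⊕ (OrientedEdge H × Fin n)) :=
  SimpleGraph.fromRel (fun x y => ∃ e : OrientedEdge H, ∃ i ≤ n,
    x = subdivisionPoint H n e i ∧ y = subdivisionPoint H n e (i + 1))

end CliquewidthQI

/-!
The graph is the `n`-subdivision of the complete graph `K_m`, `m = k - 2`, for large `n`.

*Cliquewidth.* `m + 2` colours suffice. One colour is kept for finished vertices, and the colour `a`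
marks the internal vertices that are still to be joined to the branch vertex `a`. Each subdivided
edge, without its ends, is grown as a path whose two end vertices have the colours of the branch
vertices they wait for, with the last colour as an auxiliary one (`isBuildable_path`). The disjoint
union of these paths does not contain the last colour.
Then the branch vertices are added one after the other, each with the last colour, joined to the
vertices that wait for it, and recoloured as finished together with them (`isBuildable_stage`).

*Minors.* Let `f` be a `c`-quasi-isometric embedding of the subdivision into `G'`. Balls of radius `d`
around the branch vertices and the middle parts of the subdivided edges are connected, and each ball
meets the middle parts of its edges, but all other pairs of these sets are at distance at least `d`.
Adjacent vertices have images at distance at most `2 * c`, so the neighbourhoods of radius about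
`2 * c` of the images of these sets are connected (`connected_imageNhd`), and if `d` is large compared
to `c ^ 2`, far sets have disjoint neighbourhoods. Giving to one end of each edge the part of the
corresponding set before it reaches the other end yields `K_m` as a minor
(`isMinor_of_connected_sets`).

*Treewidth.* In a tree decomposition, the bags that meet a fixed branch set of a `K_m` minor form a
subtree. These subtrees intersect pairwise, so by the Helly property (`helly_subtrees`) some bag
meets all `m` disjoint branch sets, and the width is at least `m - 1 = k - 3`.
-/

namespace CliquewidthQI

/-! ### Building induced subgraphs with colours -/

/-- Cliquewidth pairs can be renamed along a bijection of the vertex sets. -/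
theorem IsCliquewidthPair.comap_equiv {k : ℕ} {V : Type u} {G : SimpleGraph V} {c : V → Fin k}
    (h : IsCliquewidthPair k G c) :
    ∀ {V' : Type u} (e : V' ≃ V), IsCliquewidthPair k (G.comap e) (c ∘ e) := by
  induction h with
  | small G c => intro V' e; have := e.subsingleton; exact .small _ _
  | union G₁ G₂ G c₁ c₂ c h₁ h₂ e' he₁ he₂ _ _ =>
    intro V' e
    exact .union G₁ G₂ _ c₁ c₂ _ h₁ h₂ (e'.trans (SimpleGraph.Iso.comap e G).symm)
      (fun x => by simp [SimpleGraph.Iso.comap, he₁]) (fun x => by simp [SimpleGraph.Iso.comap, he₂])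
  | recolour G c' i j hij hi hj _ ih =>
    intro V' e
    obtain ⟨x, hx⟩ := hi
    obtain ⟨y, hy⟩ := hj
    exact IsCliquewidthPair.recolour (G.comap e) (c' ∘ e) i j hij ⟨e.symm x, by simp [hx]⟩
      ⟨e.symm y, by simp [hy]⟩ (ih e)
  | join G' c i j hij hproper _ ih =>
    intro V' e
    have hcomap : (joinColours G' c i j).comap e = joinColours (G'.comap e) (c ∘ e) i j := by
      ext x y
      simp [joinColours]
    rw [hcomap]
    refine .join _ _ i j hij (lt_of_le_of_ne le_sup_left fun heq => hproper.ne ?_) (ih e)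
    rw [← hcomap] at heq
    ext x y
    have := congrArg (fun A : SimpleGraph _ => A.Adj (e.symm x) (e.symm y)) heq
    simpa using this

/-- The subgraph of `G` induced by `S`, with the colours given by `c`, is a cliquewidth-`k`
pair. Only the values of `c` on `S` matter. -/
def IsBuildable {V : Type u} (k : ℕ) (G : SimpleGraph V) (S : Set V) (c : V → Fin k) : Prop :=
  IsCliquewidthPair k (G.induce S) (fun x : S => c x)

namespace IsBuildable

variable {V : Type u} {k : ℕ} {G : SimpleGraph V} {S T : Set V} {c c' : V → Fin k}

theorem congr (h : IsBuildable k G S c) (hc : ∀ x ∈ S, c x = c' x) : IsBuildable k G S c' := by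
  unfold IsBuildable at h ⊢
  have : (fun x : S => c x) = (fun x : S => c' x) := funext fun x => hc x x.2
  rwa [← this]

theorem singleton (v : V) : IsBuildable k G {v} c :=
  .small _ _

/-- A disjoint union, for a graph `A` on `S ∪ T` that agrees with `G` inside `S` and inside `T`
but has no edge between them. -/
theorem pair_union {A : SimpleGraph ↥(S ∪ T)} (hs : IsBuildable k G S c)
    (ht : IsBuildable k G T c) (hd : Disjoint S T) (hS : S.Nonempty) (hT : T.Nonempty)
    (hAS : ∀ x (hx : x ∈ S) y (hy : y ∈ S), A.Adj ⟨x, .inl hx⟩ ⟨y, .inl hy⟩ ↔ G.Adj x y)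
    (hAT : ∀ x (hx : x ∈ T) y (hy : y ∈ T), A.Adj ⟨x, .inr hx⟩ ⟨y, .inr hy⟩ ↔ G.Adj x y)
    (hAST : ∀ x (hx : x ∈ S) y (hy : y ∈ T), ¬ A.Adj ⟨x, .inl hx⟩ ⟨y, .inr hy⟩) :
    IsCliquewidthPair k A (fun x => c x) := by
  classical
  have := hS.to_subtype
  have := hT.to_subtype
  refine .union (G.induce S) (G.induce T) A _ _ _ hs ht
    { toEquiv := (Equiv.Set.union hd).symm
      map_rel_iff' := ?_ } (fun x => ?_) (fun x => ?_)
  · rintro (⟨x, hx⟩ | ⟨x, hx⟩) (⟨y, hy⟩ | ⟨y, hy⟩)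
    · simpa using hAS x hx y hy
    · simpa using hAST x hx y hy
    · simpa using fun h => hAST y hy x hx h.symm
    · simpa using hAT x hx y hy
  · simp
  · simp

theorem union (hs : IsBuildable k G S c) (ht : IsBuildable k G T c) (hd : Disjoint S T)
    (hS : S.Nonempty) (hT : T.Nonempty) (hST : ∀ x ∈ S, ∀ y ∈ T, ¬ G.Adj x y) :
    IsBuildable k G (S ∪ T) c :=
  hs.pair_union ht hd hS hT (fun _ _ _ _ => by simp) (fun _ _ _ _ => by simp)
    (fun x hx y hy => by simpa using hST x hx y hy)

theorem recolour (h : IsBuildable k G S c) {i j : Fin k} (hij : i ≠ j) (hi : ∃ x ∈ S, c x = i)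
    (hj : ∃ x ∈ S, c x = j) : IsBuildable k G S (CliquewidthQI.recolour c i j) := by
  obtain ⟨x, hxS, hx⟩ := hi
  obtain ⟨y, hyS, hy⟩ := hj
  exact IsCliquewidthPair.recolour (G.induce S) (fun x : S => c x) i j hij ⟨⟨x, hxS⟩, hx⟩
    ⟨⟨y, hyS⟩, hy⟩ h

/-- If `v` has a colour not used on `S`, and its neighbours in `S` are the vertices coloured `j`,
then `v` can be added to `S` by a disjoint union followed by a join. -/
theorem insert_vertex (h : IsBuildable k G S c) {v : V} {j : Fin k} (hv : v ∉ S) (hvj : c v ≠ j)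
    (hnew : ∀ x ∈ S, c x ≠ c v) (hadj : ∀ x ∈ S, G.Adj v x ↔ c x = j) (hj : ∃ x ∈ S, c x = j) :
    IsBuildable k G (S ∪ {v}) c := by
  obtain ⟨x₀, hx₀S, hx₀⟩ := hj
  -- the disjoint union of `S` and `v`, before the join
  let A : SimpleGraph ↥(S ∪ {v}) :=
    { Adj := fun x y => G.Adj x y ∧ x.1 ≠ v ∧ y.1 ≠ v
      symm := ⟨fun x y h => ⟨h.1.symm, h.2.2, h.2.1⟩⟩
      loopless := ⟨fun x h => h.1.ne rfl⟩ }
  have hne : ∀ x ∈ S, x ≠ v := fun x hx h => hv (h ▸ hx)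
  have hA : IsCliquewidthPair k A (fun x => c x) := by
    refine h.pair_union (singleton v) (by simpa using hv) ⟨x₀, hx₀S⟩ (Set.singleton_nonempty v)
      ?_ ?_ ?_
    · intro x hx y hy
      simp [A, hne x hx, hne y hy]
    · rintro x rfl y rfl
      simp [A]
    · rintro x hx y rfl
      simp [A]
  have hjoin : joinColours A (fun x => c x) (c v) j = G.induce (S ∪ {v}) := by
    ext ⟨x, hx⟩ ⟨y, hy⟩
    rcases hx with hx | hx <;> rcases hy with hy | hy
    · simp [joinColours, A, hne x hx, hne y hy, hnew x hx, hnew y hy]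
    · obtain rfl : y = v := hy
      simpa [joinColours, A, hne x hx, hnew x hx, ← hadj x hx, G.adj_comm]
        using fun _ h => hne x hx (congrArg Subtype.val h)
    · obtain rfl : x = v := hx
      simpa [joinColours, A, hnew y hy, hadj y hy]
        using fun _ h => hne y hy (congrArg Subtype.val h).symm
    · obtain rfl : x = v := hx
      obtain rfl : y = x := hy
      simp [joinColours, A]
  have hlt : A < joinColours A (fun x => c x) (c v) j := by
    refine lt_of_le_of_ne le_sup_left fun heq => ?_
    have : A.Adj ⟨v, .inr rfl⟩ ⟨x₀, .inl hx₀S⟩ := by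
      rw [heq, hjoin]
      simpa using (hadj x₀ hx₀S).2 hx₀
    exact this.2.1 rfl
  have := IsCliquewidthPair.join A (fun x => c x) (c v) j hvj hlt hA
  rwa [hjoin] at this

theorem cliquewidth_le (hk : 1 ≤ k) (h : IsBuildable k G Set.univ c) : cliquewidth G ≤ k :=
  sInf_le ⟨k, rfl, hk, c, IsCliquewidthPair.comap_equiv h (Equiv.Set.univ V).symm⟩

end IsBuildable

/-! ### Adjacency in a subdivision -/

section Subdivision

variable {V : Type u} [LinearOrder V] {H : SimpleGraph V} {n : ℕ}

@[simp] theorem subdivisionPoint_zero (e : OrientedEdge H) :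
    subdivisionPoint H n e 0 = Sum.inl e.1.1 := by
  simp [subdivisionPoint]

@[simp] theorem subdivisionPoint_add_one (e : OrientedEdge H) (i : Fin n) :
    subdivisionPoint H n e (i + 1) = Sum.inr (e, i) := by
  simp [subdivisionPoint]

@[simp] theorem subdivisionPoint_last (e : OrientedEdge H) :
    subdivisionPoint H n e (n + 1) = Sum.inl e.1.2 := by
  simp [subdivisionPoint]

theorem subdivisionPoint_eq_inr_iff {e e' : OrientedEdge H} {i : ℕ} {j : Fin n} :
    subdivisionPoint H n e i = Sum.inr (e', j) ↔ e = e' ∧ i = j + 1 := by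
  unfold subdivisionPoint
  split_ifs with h0 h1
  · simp [h0]
  · simp only [Sum.inr.injEq, Prod.mk.injEq, Fin.ext_iff]
    grind
  · have := j.2
    simp only [false_iff, not_and]
    omega

theorem subdivisionPoint_eq_inl_iff {e : OrientedEdge H} {i : ℕ} (hi : i ≤ n + 1) {a : V} :
    subdivisionPoint H n e i = Sum.inl a ↔ (i = 0 ∧ e.1.1 = a) ∨ (i = n + 1 ∧ e.1.2 = a) := by
  unfold subdivisionPoint
  split_ifs with h0 h1
  · simp [h0]
  · simp only [false_iff]
    omega
  · have : i = n + 1 := by omega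
    simp [this]

theorem subdivision_adj_inr_inr {e e' : OrientedEdge H} {i j : Fin n} :
    (subdivision H n).Adj (Sum.inr (e, i)) (Sum.inr (e', j)) ↔
      e = e' ∧ ((i : ℕ) + 1 = j ∨ (j : ℕ) + 1 = i) := by
  simp only [subdivision, SimpleGraph.fromRel_adj, eq_comm (a := Sum.inr _),
    subdivisionPoint_eq_inr_iff]
  constructor
  · rintro ⟨-, ⟨e'', l, -, ⟨rfl, h1⟩, rfl, h2⟩ | ⟨e'', l, -, ⟨rfl, h1⟩, rfl, h2⟩⟩
    · exact ⟨rfl, by omega⟩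
    · exact ⟨rfl, by omega⟩
  · rintro ⟨rfl, h | h⟩
    · refine ⟨?_, .inl ⟨e, i + 1, i.2, ⟨rfl, rfl⟩, rfl, by omega⟩⟩
      simp only [ne_eq, Sum.inr.injEq, Prod.mk.injEq, Fin.ext_iff]
      omega
    · refine ⟨?_, .inr ⟨e, j + 1, j.2, ⟨rfl, rfl⟩, rfl, by omega⟩⟩
      simp only [ne_eq, Sum.inr.injEq, Prod.mk.injEq, Fin.ext_iff]
      omega

theorem subdivision_adj_inl_inr {a : V} {e : OrientedEdge H} {j : Fin n} :
    (subdivision H n).Adj (Sum.inl a) (Sum.inr (e, j)) ↔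
      (e.1.1 = a ∧ (j : ℕ) = 0) ∨ (e.1.2 = a ∧ (j : ℕ) + 1 = n) := by
  simp only [subdivision, SimpleGraph.fromRel_adj, eq_comm (a := Sum.inr _),
    eq_comm (a := Sum.inl _), subdivisionPoint_eq_inr_iff]
  have hj := j.2
  constructor
  · rintro ⟨-, ⟨e', l, hl, h1, rfl, h2⟩ | ⟨e', l, hl, ⟨rfl, h2⟩, h1⟩⟩ <;>
      rw [subdivisionPoint_eq_inl_iff (by omega)] at h1 <;> grind
  · rintro (⟨h1, h2⟩ | ⟨h1, h2⟩)
    · exact ⟨by simp, .inl ⟨e, 0, by omega, by simp [h1], rfl, by omega⟩⟩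
    · exact ⟨by simp, .inr ⟨e, n, le_rfl, ⟨rfl, by omega⟩, by simp [h1]⟩⟩

theorem subdivision_not_adj_inl_inl (hn : n ≠ 0) (a b : V) :
    ¬ (subdivision H n).Adj (Sum.inl a) (Sum.inl b) := by
  simp only [subdivision, SimpleGraph.fromRel_adj, eq_comm (a := Sum.inl _)]
  rintro ⟨-, ⟨e, l, hl, h1, h2⟩ | ⟨e, l, hl, h1, h2⟩⟩ <;>
    rw [subdivisionPoint_eq_inl_iff (by omega)] at h1 h2 <;> omega

end Subdivision

/-! ### Cliquewidth of subdivided complete graphs -/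

section CompleteGraph

variable {m n k : ℕ} {H : SimpleGraph (Fin m)}

/-- The first `t` internal vertices of the subdivided edge `e`. -/
def pathInitial (e : OrientedEdge H) (n t : ℕ) : Set (Fin m ⊕ (OrientedEdge H × Fin n)) :=
  {x | ∃ j : Fin n, j < t ∧ x = Sum.inr (e, j)}

/-- The colour of the vertex at index `j` on a path of `t` vertices, if the first vertex has
colour `p`, the last one has colour `q`, and the others have colour `d`. -/
def pathColour (p q d : Fin k) (t j : ℕ) : Fin k :=
  if j = 0 then p else if j + 1 = t then q else d

/-- The path is grown one vertex at a time. The old end vertex is recoloured to `d`, so that the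
colours `q` and `q'` of the end vertex alternate. A path with three vertices is the start, as the
colour `d` has to be present for this. -/
theorem isBuildable_pathInitial (e : OrientedEdge H) {p d : Fin k} (hpd : p ≠ d) (t : ℕ)
    (ht : t + 3 ≤ n) :
    ∀ {q q' : Fin k}, q ≠ q' → p ≠ q → p ≠ q' → d ≠ q → d ≠ q' →
      IsBuildable k (subdivision H n) (pathInitial e n (t + 3))
        (Sum.elim (fun _ => d) fun y => pathColour p q d (t + 3) y.2) := by
  have hS : ∀ t (ht : t < n), pathInitial e n t ∪ {Sum.inr (e, ⟨t, ht⟩)}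
      = pathInitial e n (t + 1) := by
    intro t ht
    ext x
    simp only [pathInitial, Set.mem_union, Set.mem_ofPred_eq, Set.mem_singleton_iff]
    constructor
    · rintro (⟨j, hj, rfl⟩ | rfl)
      · exact ⟨j, by omega, rfl⟩
      · exact ⟨⟨t, ht⟩, by simp, rfl⟩
    · rintro ⟨j, hj, rfl⟩
      by_cases h : (j : ℕ) = t
      · right; simp [← h]
      · left; exact ⟨j, by omega, rfl⟩
  induction t with
  | zero =>
    intro q q' _ hpq _ hdq _
    have h1 : IsBuildable k (subdivision H n) (pathInitial e n 1)
        (Sum.elim (fun _ => d) fun y => pathColour p q d 3 y.2) := by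
      rw [← hS 0 (by omega)]
      have : pathInitial e n 0 = ∅ := by ext; simp [pathInitial]
      rw [this, Set.empty_union]
      exact .singleton _
    have h2 := h1.insert_vertex (v := Sum.inr (e, ⟨1, by omega⟩)) (j := p)
      (by simp [pathInitial]) (by simp [pathColour, hpd.symm])
      (by rintro x ⟨j, hj, rfl⟩; simp [pathColour]; grind)
      (by rintro x ⟨j, hj, rfl⟩; simp [pathColour, subdivision_adj_inr_inr]; grind)
      ⟨Sum.inr (e, ⟨0, by omega⟩), by simp [pathInitial], by simp [pathColour]⟩
    rw [hS] at h2
    have h3 := h2.insert_vertex (v := Sum.inr (e, ⟨2, by omega⟩)) (j := d)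
      (by simp [pathInitial]) (by simp [pathColour, hdq.symm])
      (by rintro x ⟨j, hj, rfl⟩; simp [pathColour]; grind)
      (by rintro x ⟨j, hj, rfl⟩; simp [pathColour, subdivision_adj_inr_inr]; grind)
      ⟨Sum.inr (e, ⟨1, by omega⟩), by simp [pathInitial], by simp [pathColour]⟩
    rwa [hS] at h3
  | succ t ih =>
    intro q q' hqq' hpq hpq' hdq hdq'
    have h1 := ih (by omega) hqq'.symm hpq' hpq hdq' hdq
    have h2 : IsBuildable k (subdivision H n) (pathInitial e n (t + 3))
        (Sum.elim (fun _ => d) fun y =>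
          if (y.2 : ℕ) = t + 3 then q else pathColour p q' d (t + 3) y.2) :=
      h1.congr (by rintro x ⟨j, hj, rfl⟩; simp; grind)
    have h3 := h2.insert_vertex (v := Sum.inr (e, ⟨t + 3, by omega⟩)) (j := q')
      (by simp [pathInitial]) (by simp [hqq'])
      (by rintro x ⟨j, hj, rfl⟩; simp [pathColour]; grind)
      (by rintro x ⟨j, hj, rfl⟩; simp [pathColour, subdivision_adj_inr_inr]; grind)
      ⟨Sum.inr (e, ⟨t + 2, by omega⟩), by simp [pathInitial], by simp [pathColour]⟩
    rw [hS] at h3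
    have h4 := h3.recolour (i := q') (j := d) hdq'.symm
      ⟨Sum.inr (e, ⟨t + 2, by omega⟩), by simp [pathInitial], by simp [pathColour]⟩
      ⟨Sum.inr (e, ⟨1, by omega⟩), by simp [pathInitial], by simp [pathColour]⟩
    refine h4.congr ?_
    rintro x ⟨j, hj, rfl⟩
    simp [pathColour, recolour]
    grind

/-- The vertex colours of the subdivided complete graph when the branch vertices below `t` have
been added. Colour `a` is for the internal vertices that still have to be joined to the branch
vertex `a`, colour `m` is for the vertices that have all their neighbours, and colour `m + 1` is
for the next branch vertex. -/
def stageColour (m n t : ℕ) :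
    Fin m ⊕ (OrientedEdge (⊤ : SimpleGraph (Fin m)) × Fin n) → Fin (m + 2)
  | .inl a => if (a : ℕ) < t then ⟨m, by omega⟩ else ⟨m + 1, by omega⟩
  | .inr (e, j) =>
      if (j : ℕ) = 0 ∧ t ≤ e.1.1 then e.1.1.castAdd 2
      else if (j : ℕ) + 1 = n ∧ t ≤ e.1.2 then e.1.2.castAdd 2
      else ⟨m, by omega⟩

/-- The internal vertices of the subdivided complete graph and the branch vertices below `t`. -/
def stage (m n t : ℕ) : Set (Fin m ⊕ (OrientedEdge (⊤ : SimpleGraph (Fin m)) × Fin n)) :=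
  {x | ∀ a, x = Sum.inl a → (a : ℕ) < t}

theorem isBuildable_path (hn : 3 ≤ n) (e : OrientedEdge (⊤ : SimpleGraph (Fin m))) :
    IsBuildable (m + 2) (subdivision (⊤ : SimpleGraph (Fin m)) n) {x | ∃ j, x = Sum.inr (e, j)}
      (stageColour m n 0) := by
  obtain ⟨t, rfl⟩ := Nat.exists_eq_add_of_le' hn
  have he : (e.1.1 : ℕ) < e.1.2 := e.2.1
  have h1 := e.1.1.2
  have h2 := e.1.2.2
  have h := isBuildable_pathInitial (k := m + 2) e (p := e.1.1.castAdd 2) (d := ⟨m, by omega⟩)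
    (by simp [Fin.ext_iff]; omega) t le_rfl (q := e.1.2.castAdd 2) (q' := ⟨m + 1, by omega⟩)
    (by simp [Fin.ext_iff]; omega) (by simp [Fin.ext_iff]; omega) (by simp [Fin.ext_iff]; omega)
    (by simp [Fin.ext_iff]; omega) (by simp [Fin.ext_iff])
  have hset : pathInitial e (t + 3) (t + 3) = {x | ∃ j, x = Sum.inr (e, j)} := by
    ext x
    simp [pathInitial]
  rw [hset] at h
  refine h.congr ?_
  rintro x ⟨j, rfl⟩
  simp [stageColour, pathColour]

theorem isBuildable_stage_zero (hm : 2 ≤ m) (hn : 3 ≤ n) :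
    IsBuildable (m + 2) (subdivision (⊤ : SimpleGraph (Fin m)) n) (stage m n 0)
      (stageColour m n 0) := by
  classical
  have key : ∀ F : Finset (OrientedEdge (⊤ : SimpleGraph (Fin m))), F.Nonempty →
      IsBuildable (m + 2) (subdivision (⊤ : SimpleGraph (Fin m)) n)
        {x | ∃ e ∈ F, ∃ j, x = Sum.inr (e, j)} (stageColour m n 0) := by
    intro F hF
    induction hF using Finset.Nonempty.cons_induction with
    | singleton e => simpa using isBuildable_path hn e
    | cons e F he hF ih =>
      have hset : {x : Fin m ⊕ (OrientedEdge (⊤ : SimpleGraph (Fin m)) × Fin n) |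
            ∃ e' ∈ Finset.cons e F he, ∃ j, x = Sum.inr (e', j)}
          = {x | ∃ j, x = Sum.inr (e, j)} ∪ {x | ∃ e' ∈ F, ∃ j, x = Sum.inr (e', j)} := by
        ext x
        simp
      rw [hset]
      obtain ⟨e₀, he₀⟩ := hF
      refine (isBuildable_path hn e).union ih ?_ ⟨_, ⟨0, by omega⟩, rfl⟩
        ⟨_, e₀, he₀, ⟨0, by omega⟩, rfl⟩ ?_
      · rw [Set.disjoint_left]
        rintro _ ⟨j, rfl⟩ ⟨e', he', j', h⟩
        obtain ⟨rfl, -⟩ := by simpa using h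
        exact he he'
      · rintro _ ⟨j, rfl⟩ _ ⟨e', he', j', rfl⟩ h
        obtain ⟨rfl, -⟩ := subdivision_adj_inr_inr.1 h
        exact he he'
  have h := key Finset.univ ⟨⟨(⟨0, by omega⟩, ⟨1, by omega⟩), by simp [Fin.ext_iff, Fin.lt_def]⟩,
    Finset.mem_univ _⟩
  have hset : {x : Fin m ⊕ (OrientedEdge (⊤ : SimpleGraph (Fin m)) × Fin n) |
      ∃ e' ∈ Finset.univ, ∃ j, x = Sum.inr (e', j)} = stage m n 0 := by
    ext x
    rcases x with a | ⟨e, j⟩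
    · simp [stage]
    · exact iff_of_true ⟨e, Finset.mem_univ _, j, rfl⟩ (by simp [stage])
  rwa [hset] at h

/-- Each branch vertex comes with a colour of its own, is joined to the internal vertices waiting
for it, and then it and these vertices become finished. -/
theorem isBuildable_stage (hm : 2 ≤ m) (hn : 3 ≤ n) (t : ℕ) (ht : t ≤ m) :
    IsBuildable (m + 2) (subdivision (⊤ : SimpleGraph (Fin m)) n) (stage m n t)
      (stageColour m n t) := by
  induction t with
  | zero => exact isBuildable_stage_zero hm hn
  | succ t ih =>
    let a : Fin m := ⟨t, ht⟩
    have hset : stage m n t ∪ {Sum.inl a} = stage m n (t + 1) := by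
      ext x
      rcases x with b | ⟨e, j⟩
      · have hb : ∀ s, Sum.inl b ∈ stage m n s ↔ (b : ℕ) < s := by simp [stage]
        rw [Set.mem_union, hb, hb, Set.mem_singleton_iff, Sum.inl.injEq, Fin.ext_iff]
        simp only [a]
        omega
      · simp [stage]
    have hwait : ∃ (e : OrientedEdge (⊤ : SimpleGraph (Fin m))) (j : Fin n),
        stageColour m n t (Sum.inr (e, j)) = a.castAdd 2 := by
      by_cases h0 : t = 0
      · exact ⟨⟨(a, ⟨1, by omega⟩), by simp [a, Fin.ext_iff, Fin.lt_def, h0]⟩, ⟨0, by omega⟩,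
          by simp [stageColour, a]⟩
      · refine ⟨⟨(⟨0, by omega⟩, a), by simp [a, Fin.ext_iff, Fin.lt_def]; omega⟩,
          ⟨n - 1, by omega⟩, ?_⟩
        have h1 : n - 1 ≠ 0 := by omega
        have h2 : n - 1 + 1 = n := by omega
        simp [stageColour, a, h0, h2]
    obtain ⟨e₀, j₀, h₀⟩ := hwait
    have hadd := (ih (by omega)).insert_vertex (v := Sum.inl a) (j := a.castAdd 2)
      (by simp [stage, a]) (by simp [stageColour, a, Fin.ext_iff]; omega) ?_ ?_
      ⟨Sum.inr (e₀, j₀), by simp [stage], h₀⟩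
    · rw [hset] at hadd
      have hdone : stageColour m n t (Sum.inr (e₀, ⟨1, by omega⟩)) = ⟨m, by omega⟩ := by
        simp [stageColour]
        omega
      have h1 := hadd.recolour (i := a.castAdd 2) (j := ⟨m, by omega⟩)
        (by simp [a, Fin.ext_iff]; omega)
        ⟨Sum.inr (e₀, j₀), by simp [stage], h₀⟩
        ⟨Sum.inr (e₀, ⟨1, by omega⟩), by simp [stage], hdone⟩
      have h2 := h1.recolour (i := ⟨m + 1, by omega⟩) (j := ⟨m, by omega⟩)
        (by simp [Fin.ext_iff])
        ⟨Sum.inl a, by simp [stage, a], by simp [recolour, stageColour, a, Fin.ext_iff]; omega⟩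
        ⟨Sum.inr (e₀, ⟨1, by omega⟩), by simp [stage], by simp [recolour, hdone]⟩
      refine h2.congr ?_
      rintro (b | ⟨e, j⟩) hx
      · have hb : (b : ℕ) < t + 1 := hx b rfl
        simp [recolour, stageColour, Fin.ext_iff]
        grind
      · have he1 := e.1.1.2
        have he2 := e.1.2.2
        have he : (e.1.1 : ℕ) < e.1.2 := e.2.1
        simp only [recolour, stageColour, a, Fin.ext_iff]
        grind
    · rintro (b | ⟨e, j⟩) hx
      · have hb : (b : ℕ) < t := hx b rfl
        simp [stageColour, hb, a]
      · have he1 := e.1.1.2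
        have he2 := e.1.2.2
        simp [stageColour, a, Fin.ext_iff]
        grind
    · rintro (b | ⟨e, j⟩) hx
      · have hb : (b : ℕ) < t := hx b rfl
        simp [stageColour, hb, a, Fin.ext_iff, subdivision_not_adj_inl_inl (show n ≠ 0 by omega)]
        omega
      · have he1 := e.1.1.2
        have he2 := e.1.2.2
        rw [subdivision_adj_inl_inr]
        simp only [stageColour, a, Fin.ext_iff]
        grind

theorem cliquewidth_subdivision_completeGraph_le (hm : 2 ≤ m) (hn : 3 ≤ n) :
    cliquewidth (subdivision (⊤ : SimpleGraph (Fin m)) n) ≤ (m + 2 : ℕ) := by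
  have h := isBuildable_stage hm hn m le_rfl
  have hset : stage m n m = Set.univ := by
    ext x
    simp [stage]
  rw [hset] at h
  exact h.cliquewidth_le (by omega)

end CompleteGraph

/-! ### Connected sets and walks -/

section Walks

variable {V : Type u} {G : SimpleGraph V} {S : Set V}

theorem exists_walk_of_preconnected_induce (h : (G.induce S).Preconnected) {x y : V} (hx : x ∈ S)
    (hy : y ∈ S) : ∃ p : G.Walk x y, ∀ z ∈ p.support, z ∈ S := by
  obtain ⟨p⟩ := h ⟨x, hx⟩ ⟨y, hy⟩
  let φ : G.induce S →g G := ⟨Subtype.val, fun h => h⟩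
  refine ⟨p.map φ, fun z hz => ?_⟩
  rw [SimpleGraph.Walk.support_map, List.mem_map] at hz
  obtain ⟨w, -, rfl⟩ := hz
  exact w.2

theorem connected_induce_of_walks {x : V} (hx : x ∈ S)
    (h : ∀ y ∈ S, ∃ p : G.Walk x y, ∀ z ∈ p.support, z ∈ S) : (G.induce S).Connected := by
  rw [SimpleGraph.connected_iff_exists_forall_reachable]
  refine ⟨⟨x, hx⟩, fun ⟨y, hy⟩ => ?_⟩
  obtain ⟨p, hp⟩ := h y hy
  exact ⟨p.induce S hp⟩

/-- A walk that ends in `S` has an initial part that stops just before it first enters `S`. -/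
theorem exists_walk_to_boundary {x y : V} (p : G.Walk x y) (hx : x ∉ S) (hy : y ∈ S) :
    ∃ (z : V) (q : G.Walk x z), (∀ w ∈ q.support, w ∈ p.support ∧ w ∉ S) ∧
      ∃ w ∈ S, G.Adj z w := by
  induction p with
  | nil => exact absurd hy hx
  | @cons x x' y hadj p ih =>
    by_cases hx' : x' ∈ S
    · exact ⟨x, .nil, by simpa using hx, x', hx', hadj⟩
    · obtain ⟨z, q, hq, hz⟩ := ih hx' hy
      refine ⟨z, .cons hadj q, ?_, hz⟩
      intro w hw
      rw [SimpleGraph.Walk.support_cons, List.mem_cons] at hw ⊢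
      rcases hw with rfl | hw
      · exact ⟨.inl rfl, hx⟩
      · exact ⟨.inr (hq w hw).1, (hq w hw).2⟩

theorem exists_walk_of_edist_le {x y : V} {M : ℕ} (h : G.edist x y ≤ M) :
    ∃ p : G.Walk x y, ∀ z ∈ p.support, G.edist x z ≤ M := by
  classical
  obtain ⟨p, hp⟩ := SimpleGraph.exists_walk_of_edist_ne_top
    (ne_top_of_le_ne_top (ENat.natCast_ne_top M) h)
  refine ⟨p, fun z hz => ?_⟩
  calc G.edist x z ≤ (p.takeUntil z hz).length := SimpleGraph.edist_le _
    _ ≤ p.length := by exact_mod_cast p.length_takeUntil_le_length hz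
    _ ≤ M := hp ▸ h

/-- A function on the vertices that grows by at most one along each edge bounds distances from
below. -/
theorem le_edist_of_potential {φ : V → ℕ} (hφ : ∀ x y, G.Adj x y → φ y ≤ φ x + 1) {x y : V}
    {d : ℕ} (h : φ x + d ≤ φ y) : (d : ℕ∞) ≤ G.edist x y := by
  have key : ∀ {x y : V} (p : G.Walk x y), φ y ≤ φ x + p.length := by
    intro x y p
    induction p with
    | nil => simp
    | @cons x x' y hadj p ih =>
      have := hφ x x' hadj
      rw [SimpleGraph.Walk.length_cons]
      omega
  refine le_iInf fun p => ?_
  have := key p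
  exact_mod_cast (by omega : d ≤ p.length)

end Walks

/-! ### Minors from overlapping connected sets -/

/-- A graph `H` is a minor of `G` if there are connected sets `X a` for the vertices and `P e` for
the edges of `H` such that `P e` meets the sets `X a` of its two ends, and all other pairs of sets
are disjoint. The branch set of `a` consists of `X a` and, for each edge `e` with smaller
endpoint `a`, the part of `P e` before it reaches the set of the larger endpoint. -/
theorem isMinor_of_connected_sets {U : Type v} [LinearOrder U] {V : Type u} {H : SimpleGraph U}
    {G : SimpleGraph V} (X : U → Set V) (P : OrientedEdge H → Set V)
    (hX : ∀ a, (G.induce (X a)).Connected) (hP : ∀ e, (G.induce (P e)).Connected)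
    (hXX : ∀ a b, a ≠ b → Disjoint (X a) (X b)) (hPP : ∀ e e', e ≠ e' → Disjoint (P e) (P e'))
    (hXP : ∀ a e, a ≠ e.1.1 → a ≠ e.1.2 → Disjoint (X a) (P e))
    (hXP₁ : ∀ e, (X e.1.1 ∩ P e).Nonempty) (hXP₂ : ∀ e, (X e.1.2 ∩ P e).Nonempty) :
    IsMinor H G := by
  have hQ : ∀ e : OrientedEdge H, ∃ Q ⊆ P e, Disjoint Q (X e.1.2) ∧ (G.induce Q).Connected ∧
      (X e.1.1 ∩ Q).Nonempty ∧ ∃ z ∈ Q, ∃ w ∈ X e.1.2, G.Adj z w := by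
    intro e
    obtain ⟨x, hxX, hxP⟩ := hXP₁ e
    obtain ⟨y, hyX, hyP⟩ := hXP₂ e
    obtain ⟨p, hp⟩ := exists_walk_of_preconnected_induce (hP e).preconnected hxP hyP
    obtain ⟨z, q, hq, w, hw, hzw⟩ := exists_walk_to_boundary p
      (Set.disjoint_left.1 (hXX _ _ e.2.1.ne) hxX) hyX
    exact ⟨{w | w ∈ q.support}, fun w hw => hp w (hq w hw).1,
      Set.disjoint_left.2 fun w hw => (hq w hw).2, q.connected_induce_support,
      ⟨x, hxX, q.start_mem_support⟩, z, q.end_mem_support, w, hw, hzw⟩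
  choose Q hQP hQX hQc hQ₁ hQ₂ using hQ
  have hXQ : ∀ a (e : OrientedEdge H), e.1.1 ≠ a → Disjoint (X a) (Q e) := by
    intro a e hae
    by_cases h2 : a = e.1.2
    · exact h2 ▸ (hQX e).symm
    · exact (hXP a e hae.symm h2).mono_right (hQP e)
  refine ⟨fun a => X a ∪ ⋃ (e : OrientedEdge H) (_ : e.1.1 = a), Q e, fun a => ?_,
    fun a b hab => ?_, fun a b hab => ?_⟩
  · obtain ⟨⟨x, hx⟩⟩ := (hX a).nonempty
    refine G.induce_connected_of_patches x (.inl hx) ?_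
    rintro y (hy | hy)
    · exact ⟨X a, Set.subset_union_left, hx, hy, (hX a).preconnected _ _⟩
    · simp only [Set.mem_iUnion] at hy
      obtain ⟨e, rfl, hy⟩ := hy
      refine ⟨X e.1.1 ∪ Q e, Set.union_subset_union_right _ ?_, .inl hx, .inr hy,
        (G.induce_union_connected (hX _).preconnected (hQc e).preconnected
          (hQ₁ e)).preconnected _ _⟩
      exact Set.subset_iUnion₂_of_subset e rfl subset_rfl
  · simp only [Set.disjoint_union_left, Set.disjoint_union_right, Set.disjoint_iUnion_left,
      Set.disjoint_iUnion_right]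
    refine ⟨⟨hXX a b hab, ?_⟩, ?_⟩
    · rintro e rfl
      exact (hXQ b e hab).symm
    · rintro e rfl
      refine ⟨hXQ a e hab.symm, ?_⟩
      rintro e' rfl
      exact (hPP e' e (fun h => hab (h ▸ rfl))).mono (hQP e') (hQP e)
  · have key : ∀ e : OrientedEdge H, ∃ x ∈ X e.1.1 ∪ ⋃ (e' : OrientedEdge H)
        (_ : e'.1.1 = e.1.1), Q e', ∃ y ∈ X e.1.2, G.Adj x y := by
      intro e
      obtain ⟨z, hz, w, hw, hzw⟩ := hQ₂ e
      exact ⟨z, .inr (Set.mem_biUnion (s := {e' : OrientedEdge H | e'.1.1 = e.1.1}) rfl hz),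
        w, hw, hzw⟩
    rcases lt_or_gt_of_ne hab.ne with h | h
    · obtain ⟨x, hx, y, hy, hxy⟩ := key ⟨(a, b), h, hab⟩
      exact ⟨x, hx, y, .inl hy, hxy⟩
    · obtain ⟨x, hx, y, hy, hxy⟩ := key ⟨(b, a), h, hab.symm⟩
      exact ⟨y, .inl hy, x, hx, hxy.symm⟩

/-! ### Neighbourhoods of images -/

section Neighbourhood

variable {V : Type u} {W : Type v} {G : SimpleGraph V} {H : SimpleGraph W} {f : V → W} {M : ℕ}
  {S T : Set V}

/-- The set of vertices of `H` at distance at most `M` from the image of `S` under `f`. -/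
def imageNhd (H : SimpleGraph W) (f : V → W) (M : ℕ) (S : Set V) : Set W :=
  {w | ∃ x ∈ S, H.edist (f x) w ≤ M}

theorem mem_imageNhd {x : V} (hx : x ∈ S) : f x ∈ imageNhd H f M S :=
  ⟨x, hx, by simp⟩

theorem connected_imageNhd (hf : ∀ x y, G.Adj x y → H.edist (f x) (f y) ≤ M)
    (hS : (G.induce S).Connected) : (H.induce (imageNhd H f M S)).Connected := by
  have step : ∀ x ∈ S, ∀ w, H.edist (f x) w ≤ M →
      ∃ p : H.Walk (f x) w, ∀ z ∈ p.support, z ∈ imageNhd H f M S := by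
    intro x hx w hw
    obtain ⟨p, hp⟩ := exists_walk_of_edist_le hw
    exact ⟨p, fun z hz => ⟨x, hx, hp z hz⟩⟩
  have lift : ∀ {x y : V} (p : G.Walk x y), (∀ z ∈ p.support, z ∈ S) →
      ∃ q : H.Walk (f x) (f y), ∀ z ∈ q.support, z ∈ imageNhd H f M S := by
    intro x y p
    induction p with
    | nil => exact fun h => ⟨.nil, by simpa using mem_imageNhd (h _ (by simp))⟩
    | @cons x x' y hadj p ih =>
      intro h
      obtain ⟨q, hq⟩ := ih fun z hz => h z (by simp [hz])
      obtain ⟨r, hr⟩ := step x (h x (by simp)) (f x') (hf x x' hadj)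
      refine ⟨r.append q, fun z hz => ?_⟩
      rw [SimpleGraph.Walk.mem_support_append_iff] at hz
      exact hz.elim (hr z) (hq z)
  obtain ⟨⟨x, hx⟩⟩ := hS.nonempty
  refine connected_induce_of_walks (mem_imageNhd hx) ?_
  rintro w ⟨y, hy, hw⟩
  obtain ⟨p, hp⟩ := exists_walk_of_preconnected_induce hS.preconnected hx hy
  obtain ⟨q, hq⟩ := lift p hp
  obtain ⟨r, hr⟩ := step y hy w hw
  refine ⟨q.append r, fun z hz => ?_⟩
  rw [SimpleGraph.Walk.mem_support_append_iff] at hz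
  exact hz.elim (hq z) (hr z)

theorem disjoint_imageNhd (h : ∀ x ∈ S, ∀ y ∈ T, ((2 * M : ℕ) : ℕ∞) < H.edist (f x) (f y)) :
    Disjoint (imageNhd H f M S) (imageNhd H f M T) := by
  rw [Set.disjoint_left]
  rintro w ⟨x, hx, hxw⟩ ⟨y, hy, hyw⟩
  refine (h x hx y hy).not_ge ?_
  calc H.edist (f x) (f y) ≤ H.edist (f x) w + H.edist w (f y) := SimpleGraph.edist_triangle
    _ ≤ M + M := by
      rw [SimpleGraph.edist_comm (u := w)]
      exact add_le_add hxw hyw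
    _ = ((2 * M : ℕ) : ℕ∞) := by push_cast; ring

end Neighbourhood

/-! ### Distances in a subdivision -/

section SubdivisionMetric

variable {U : Type u} [LinearOrder U] {H : SimpleGraph U} {n : ℕ}

theorem subdivision_adj_point {e : OrientedEdge H} {i : ℕ} (hi : i ≤ n) :
    (subdivision H n).Adj (subdivisionPoint H n e i) (subdivisionPoint H n e (i + 1)) := by
  rw [subdivision, SimpleGraph.fromRel_adj]
  refine ⟨fun h => ?_, .inl ⟨e, i, hi, rfl, rfl⟩⟩
  by_cases hin : i < n
  · have := (subdivisionPoint_eq_inr_iff.1 (h.trans (subdivisionPoint_add_one e ⟨i, hin⟩))).2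
    simp at this
  · obtain rfl : i = n := by omega
    rw [subdivisionPoint_last, subdivisionPoint_eq_inl_iff (by omega)] at h
    have := e.2.1.ne
    grind

theorem exists_walk_subdivisionPoint (e : OrientedEdge H) {i j : ℕ} (hij : i ≤ j)
    (hj : j ≤ n + 1) :
    ∃ p : (subdivision H n).Walk (subdivisionPoint H n e i) (subdivisionPoint H n e j),
      ∀ z ∈ p.support, ∃ l, i ≤ l ∧ l ≤ j ∧ z = subdivisionPoint H n e l := by
  induction j, hij using Nat.le_induction with
  | base => exact ⟨.nil, by simpa using ⟨i, le_rfl, le_rfl, rfl⟩⟩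
  | succ j hij ih =>
    obtain ⟨p, hp⟩ := ih (by omega)
    refine ⟨p.concat (subdivision_adj_point (by omega)), fun z hz => ?_⟩
    rw [SimpleGraph.Walk.support_concat, List.mem_append,
      List.mem_singleton] at hz
    rcases hz with hz | rfl
    · obtain ⟨l, h1, h2, h3⟩ := hp z hz
      exact ⟨l, h1, by omega, h3⟩
    · exact ⟨j + 1, by omega, le_rfl, rfl⟩

/-- A potential on the subdivision is checked along the subdivided edges. -/
theorem subdivision_lipschitz {φ : U ⊕ (OrientedEdge H × Fin n) → ℕ}
    (h : ∀ e : OrientedEdge H, ∀ i ≤ n,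
      φ (subdivisionPoint H n e i) ≤ φ (subdivisionPoint H n e (i + 1)) + 1 ∧
      φ (subdivisionPoint H n e (i + 1)) ≤ φ (subdivisionPoint H n e i) + 1) :
    ∀ x y, (subdivision H n).Adj x y → φ y ≤ φ x + 1 := by
  intro x y hxy
  rw [subdivision, SimpleGraph.fromRel_adj] at hxy
  obtain ⟨-, ⟨e, i, hi, rfl, rfl⟩ | ⟨e, i, hi, rfl, rfl⟩⟩ := hxy
  · exact (h e i hi).2
  · exact (h e i hi).1

/-- The distance from the branch vertex `a` along the subdivided edges at `a`, and the value
`n + 1` on all other edges. -/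
def vertexPotential (n : ℕ) (a : U) : U ⊕ (OrientedEdge H × Fin n) → ℕ
  | .inl b => if b = a then 0 else n + 1
  | .inr (e, j) => if e.1.1 = a then j + 1 else if e.1.2 = a then n - j else n + 1

/-- The distance to the nearer end along the subdivided edge `e`, and the value `0` outside it. -/
def edgePotential [DecidableEq (OrientedEdge H)] (n : ℕ) (e : OrientedEdge H) :
    U ⊕ (OrientedEdge H × Fin n) → ℕ
  | .inl _ => 0
  | .inr (e', j) => if e' = e then min (j + 1) (n - j) else 0

theorem vertexPotential_point (a : U) (e : OrientedEdge H) {i : ℕ} (hi : i ≤ n + 1) :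
    vertexPotential n a (subdivisionPoint H n e i) =
      if e.1.1 = a then i else if e.1.2 = a then n + 1 - i else n + 1 := by
  have := e.2.1.ne
  unfold subdivisionPoint
  split_ifs <;> simp [vertexPotential] <;> grind

theorem edgePotential_point [DecidableEq (OrientedEdge H)] (e e' : OrientedEdge H) {i : ℕ}
    (hi : i ≤ n + 1) :
    edgePotential n e (subdivisionPoint H n e' i) = if e' = e then min i (n + 1 - i) else 0 := by
  unfold subdivisionPoint
  split_ifs <;> simp [edgePotential] <;> grind

theorem vertexPotential_lipschitz (a : U) : ∀ x y, (subdivision H n).Adj x y →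
    vertexPotential n a y ≤ vertexPotential n a x + 1 := by
  refine subdivision_lipschitz fun e i hi => ?_
  rw [vertexPotential_point a e (by omega), vertexPotential_point a e (by omega)]
  split_ifs <;> omega

theorem edgePotential_lipschitz [DecidableEq (OrientedEdge H)] (e : OrientedEdge H) :
    ∀ x y, (subdivision H n).Adj x y → edgePotential n e y ≤ edgePotential n e x + 1 := by
  refine subdivision_lipschitz fun e' i hi => ?_
  rw [edgePotential_point e e' (by omega), edgePotential_point e e' (by omega)]
  split_ifs <;> omega

/-- The ball of radius `r` around the branch vertex `a`, for `r ≤ n`. -/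
def branchBall (n r : ℕ) (a : U) : Set (U ⊕ (OrientedEdge H × Fin n)) :=
  {x | vertexPotential n a x ≤ r}

/-- The vertices of the subdivided edge `e` at distance at least `r` from both ends along `e`. -/
def edgeMiddle (n r : ℕ) (e : OrientedEdge H) : Set (U ⊕ (OrientedEdge H × Fin n)) :=
  {x | ∃ l, r ≤ l ∧ l ≤ n + 1 - r ∧ x = subdivisionPoint H n e l}

theorem connected_edgeMiddle {r : ℕ} (hr : 2 * r ≤ n + 1) (e : OrientedEdge H) :
    ((subdivision H n).induce (edgeMiddle n r e)).Connected := by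
  refine connected_induce_of_walks ⟨r, le_rfl, by omega, rfl⟩ ?_
  rintro _ ⟨l, h1, h2, rfl⟩
  obtain ⟨p, hp⟩ := exists_walk_subdivisionPoint (n := n) e h1 (by omega)
  refine ⟨p, fun z hz => ?_⟩
  obtain ⟨j, hj1, hj2, rfl⟩ := hp z hz
  exact ⟨j, hj1, by omega, rfl⟩

theorem connected_branchBall {r : ℕ} (hr : r ≤ n) (a : U) :
    ((subdivision H n).induce (branchBall n r a)).Connected := by
  refine connected_induce_of_walks (x := Sum.inl a) (by simp [branchBall, vertexPotential]) ?_
  rintro (b | ⟨e, j⟩) hx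
  · obtain rfl : b = a := by
      by_contra hne
      simp [branchBall, vertexPotential, hne] at hx
      omega
    exact ⟨.nil, by simpa using hx⟩
  · have hj := j.2
    have hne := e.2.1.ne
    by_cases h1 : e.1.1 = a
    · obtain ⟨p, hp⟩ := exists_walk_subdivisionPoint (n := n) e (i := 0) (j := j + 1)
        (by omega) (by omega)
      simp only [branchBall, Set.mem_ofPred_eq, vertexPotential, h1, if_true] at hx
      refine ⟨p.copy (by simp [h1]) (by simp), fun z hz => ?_⟩
      rw [SimpleGraph.Walk.support_copy] at hz
      obtain ⟨l, -, hl, rfl⟩ := hp z hz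
      simp only [branchBall, Set.mem_ofPred_eq]
      rw [vertexPotential_point a e (by omega), if_pos h1]
      omega
    · by_cases h2 : e.1.2 = a
      · obtain ⟨p, hp⟩ := exists_walk_subdivisionPoint (n := n) e (i := j + 1) (j := n + 1)
          (by omega) le_rfl
        simp only [branchBall, Set.mem_ofPred_eq, vertexPotential, h1, h2, if_true, if_false] at hx
        refine ⟨p.reverse.copy (by simp [h2]) (by simp), fun z hz => ?_⟩
        rw [SimpleGraph.Walk.support_copy, SimpleGraph.Walk.support_reverse,
          List.mem_reverse] at hz
        obtain ⟨l, hl, hl', rfl⟩ := hp z hz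
        simp only [branchBall, Set.mem_ofPred_eq]
        rw [vertexPotential_point a e hl', if_neg h1, if_pos h2]
        omega
      · simp [branchBall, vertexPotential, h1, h2] at hx
        omega

theorem le_edist_branchBall {r d : ℕ} (hrd : 2 * r + d ≤ n + 1) {a b : U} (hab : a ≠ b)
    {x y : U ⊕ (OrientedEdge H × Fin n)} (hx : x ∈ branchBall n r a) (hy : y ∈ branchBall n r b) :
    (d : ℕ∞) ≤ (subdivision H n).edist x y := by
  refine le_edist_of_potential (vertexPotential_lipschitz a) ?_
  simp only [branchBall, Set.mem_ofPred_eq] at hx hy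
  have : n + 1 ≤ vertexPotential n a y + r := by
    rcases y with c | ⟨e, j⟩
    · simp only [vertexPotential] at hy ⊢
      split_ifs at * <;> grind
    · have hj := j.2
      simp only [vertexPotential] at hy ⊢
      split_ifs at * <;> grind
  omega

theorem le_edist_branchBall_edgeMiddle {r d : ℕ} (hrd : r + d ≤ n + 1) {a : U}
    {e : OrientedEdge H} (h₁ : a ≠ e.1.1) (h₂ : a ≠ e.1.2) {x y : U ⊕ (OrientedEdge H × Fin n)}
    (hx : x ∈ branchBall n r a) (hy : y ∈ edgeMiddle n r e) :
    (d : ℕ∞) ≤ (subdivision H n).edist x y := by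
  refine le_edist_of_potential (vertexPotential_lipschitz a) ?_
  obtain ⟨l, -, hl, rfl⟩ := hy
  rw [vertexPotential_point a e (by omega), if_neg h₁.symm, if_neg h₂.symm]
  simp only [branchBall, Set.mem_ofPred_eq] at hx
  omega

theorem le_edist_edgeMiddle {r : ℕ} {e e' : OrientedEdge H} (hr : 2 * r ≤ n + 1) (hee' : e ≠ e')
    {x y : U ⊕ (OrientedEdge H × Fin n)} (hx : x ∈ edgeMiddle n r e)
    (hy : y ∈ edgeMiddle n r e') : (r : ℕ∞) ≤ (subdivision H n).edist x y := by
  classical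
  refine le_edist_of_potential (edgePotential_lipschitz e') ?_
  obtain ⟨l, hl1, hl2, rfl⟩ := hx
  obtain ⟨l', hl1', hl2', rfl⟩ := hy
  rw [edgePotential_point e' e (by omega), edgePotential_point e' e' (by omega), if_neg hee',
    if_pos rfl]
  omega

end SubdivisionMetric

/-! ### Quasi-isometric embeddings of subdivisions -/

theorem IsQIEmbedding.edist_le_of_adj {V : Type u} {W : Type v} {G : SimpleGraph V}
    {H : SimpleGraph W} {f : V → W} {c : ℝ} (hc : 0 ≤ c) (hf : IsQIEmbedding c G H f) {M : ℕ}
    (hM : 2 * c ≤ M) {x y : V} (hxy : G.Adj x y) : H.edist (f x) (f y) ≤ M := by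
  have h := (hf x y).2
  rw [SimpleGraph.edist_eq_one_iff_adj.2 hxy, ENat.toENNReal_one, mul_one,
    ← ENNReal.ofReal_add hc hc] at h
  have h2 : (H.edist (f x) (f y) : ℝ≥0∞) ≤ ((M : ℕ∞) : ℝ≥0∞) := by
    refine h.trans ?_
    rw [ENat.toENNReal_coe, ← ENNReal.ofReal_natCast]
    exact ENNReal.ofReal_le_ofReal (by linarith)
  exact ENat.toENNReal_le.1 h2

theorem IsQIEmbedding.lt_edist {V : Type u} {W : Type v} {G : SimpleGraph V}
    {H : SimpleGraph W} {f : V → W} {c : ℝ} (hc : 0 < c) (hf : IsQIEmbedding c G H f) {M d : ℕ}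
    (hd : c * (M + c) < d) {x y : V} (hxy : (d : ℕ∞) ≤ G.edist x y) :
    (M : ℕ∞) < H.edist (f x) (f y) := by
  by_contra! hle
  have h := (hf x y).1.trans (ENat.toENNReal_le.2 hle)
  rw [tsub_le_iff_right, ENNReal.div_le_iff (by simpa using hc) ENNReal.ofReal_ne_top,
    ENat.toENNReal_coe, ← ENNReal.ofReal_natCast, ← ENNReal.ofReal_add (by positivity) hc.le,
    ← ENNReal.ofReal_mul (by positivity)] at h
  have h2 := (ENat.toENNReal_le.2 hxy).trans h
  rw [ENat.toENNReal_coe, ← ENNReal.ofReal_natCast,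
    ENNReal.ofReal_le_ofReal_iff (by positivity)] at h2
  linarith

/-- If the edges of `H` are subdivided often enough, then `H` is a minor of every graph into which
the subdivision is `c`-quasi-isometrically embeddable. -/
theorem isMinor_of_qiEmbeddable {U : Type u} [LinearOrder U] {W : Type v} {H : SimpleGraph U}
    {G : SimpleGraph W} {c : ℝ} (hc : 1 ≤ c) {d n : ℕ} (hd : 8 * c * (c + 1) ≤ d)
    (hn : 3 * d ≤ n) (h : QIEmbeddable c (subdivision H n) G) : IsMinor H G := by
  obtain ⟨f, hf⟩ := h
  obtain ⟨M, hM, hM'⟩ : ∃ M : ℕ, 2 * c ≤ M ∧ (M : ℝ) < 2 * c + 1 :=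
    ⟨⌈2 * c⌉₊, Nat.le_ceil _, Nat.ceil_lt_add_one (by linarith)⟩
  have hadj : ∀ x y, (subdivision H n).Adj x y → G.edist (f x) (f y) ≤ M :=
    fun x y => hf.edist_le_of_adj (by linarith) hM
  have hfar : ∀ x y, (d : ℕ∞) ≤ (subdivision H n).edist x y →
      ((2 * M : ℕ) : ℕ∞) < G.edist (f x) (f y) := by
    refine fun x y => hf.lt_edist (by linarith) ?_
    -- `c * (2 * M + c) ≤ c * (5 * c + 2) < 8 * c * (c + 1) ≤ d`
    push_cast
    nlinarith
  have hd1 : 1 ≤ d := by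
    have : (0 : ℝ) < d := lt_of_lt_of_le (by positivity) hd
    exact_mod_cast this
  refine isMinor_of_connected_sets (fun a => imageNhd G f M (branchBall n d a))
    (fun e => imageNhd G f M (edgeMiddle n d e))
    (fun a => connected_imageNhd hadj (connected_branchBall (by omega) a))
    (fun e => connected_imageNhd hadj (connected_edgeMiddle (by omega) e))
    (fun a b hab => disjoint_imageNhd fun x hx y hy =>
      hfar x y (le_edist_branchBall (by omega) hab hx hy))
    (fun e e' hee' => disjoint_imageNhd fun x hx y hy =>
      hfar x y (le_edist_edgeMiddle (by omega) hee' hx hy))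
    (fun a e h₁ h₂ => disjoint_imageNhd fun x hx y hy =>
      hfar x y (le_edist_branchBall_edgeMiddle (by omega) h₁ h₂ hx hy))
    (fun e => ⟨f (subdivisionPoint H n e d), mem_imageNhd ?_,
      mem_imageNhd ⟨d, le_rfl, by omega, rfl⟩⟩)
    (fun e => ⟨f (subdivisionPoint H n e (n + 1 - d)), mem_imageNhd ?_,
      mem_imageNhd ⟨n + 1 - d, by omega, le_rfl, rfl⟩⟩)
  · simp only [branchBall, Set.mem_ofPred_eq]
    rw [vertexPotential_point _ e (by omega), if_pos rfl]
  · simp only [branchBall, Set.mem_ofPred_eq]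
    rw [vertexPotential_point _ e (by omega), if_neg e.2.1.ne, if_pos rfl]
    omega

/-! ### Subtrees of a tree -/

section Tree

variable {ι : Type v} {T : SimpleGraph ι}

/-- Every connected set of vertices of a tree contains the paths between its vertices. -/
theorem support_subset_of_isPath (hT : T.IsTree) {A : Set ι} (hA : (T.induce A).Preconnected)
    {x y : ι} (hx : x ∈ A) (hy : y ∈ A) {p : T.Walk x y} (hp : p.IsPath) :
    ∀ z ∈ p.support, z ∈ A := by
  classical
  obtain ⟨q, hq⟩ := exists_walk_of_preconnected_induce hA hx hy
  obtain rfl : p = q.bypass := (hT.existsUnique_path x y).unique hp q.bypass_isPath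
  exact fun z hz => hq z (q.support_bypass_subset_support hz)

theorem preconnected_induce_inter (hT : T.IsTree) {A B : Set ι} (hA : (T.induce A).Preconnected)
    (hB : (T.induce B).Preconnected) : (T.induce (A ∩ B)).Preconnected := by
  rintro ⟨x, hxA, hxB⟩ ⟨y, hyA, hyB⟩
  obtain ⟨p, hp, -⟩ := hT.existsUnique_path x y
  exact ⟨p.induce (A ∩ B) fun z hz => ⟨support_subset_of_isPath hT hA hxA hyA hp z hz,
    support_subset_of_isPath hT hB hxB hyB hp z hz⟩⟩

/-- A walk from `A` to `C` each of whose edges lies in `A` or in `C` meets `A ∩ C`. -/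
theorem exists_mem_inter_of_walk {A C : Set ι} {x y : ι} (p : T.Walk x y) (hx : x ∈ A)
    (hy : y ∈ C)
    (h : ∀ u v, s(u, v) ∈ p.edges → (u ∈ A ∧ v ∈ A) ∨ (u ∈ C ∧ v ∈ C)) :
    ∃ z ∈ p.support, z ∈ A ∧ z ∈ C := by
  induction p with
  | nil => exact ⟨_, by simp, hx, hy⟩
  | @cons x x' y hadj p ih =>
    rcases h x x' (by simp) with h' | h'
    · obtain ⟨z, hz, hzAC⟩ := ih h'.2 hy fun u v huv => h u v (by simp [huv])
      exact ⟨z, by simp [hz], hzAC⟩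
    · exact ⟨x, by simp, hx, h'.1⟩

/-- For three pairwise intersecting subtrees `A`, `B`, `C`, the path in `B` from a vertex of
`A ∩ B` to a vertex of `B ∩ C` is covered edge by edge by a walk inside `A` followed by a walk
inside `C`, so it meets `A ∩ C`. -/
theorem inter_three_nonempty (hT : T.IsTree) {A B C : Set ι} (hA : (T.induce A).Preconnected)
    (hB : (T.induce B).Preconnected) (hC : (T.induce C).Preconnected) (hAB : (A ∩ B).Nonempty)
    (hBC : (B ∩ C).Nonempty) (hAC : (A ∩ C).Nonempty) : (A ∩ B ∩ C).Nonempty := by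
  classical
  obtain ⟨x, hxA, hxB⟩ := hAB
  obtain ⟨y, hyB, hyC⟩ := hBC
  obtain ⟨z, hzA, hzC⟩ := hAC
  obtain ⟨p, hp⟩ := exists_walk_of_preconnected_induce hA hxA hzA
  obtain ⟨q, hq⟩ := exists_walk_of_preconnected_induce hC hzC hyC
  have hpath := (p.append q).bypass_isPath
  obtain ⟨w, hw, hwA, hwC⟩ := exists_mem_inter_of_walk (A := A) (C := C) (p.append q).bypass
    hxA hyC (by
      intro u v huv
      have huv' := (p.append q).edges_bypass_subset_edges huv
      rw [SimpleGraph.Walk.edges_append, List.mem_append] at huv'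
      rcases huv' with h | h
      · exact .inl ⟨hp _ (p.fst_mem_support_of_mem_edges h),
          hp _ (p.snd_mem_support_of_mem_edges h)⟩
      · exact .inr ⟨hq _ (q.fst_mem_support_of_mem_edges h),
          hq _ (q.snd_mem_support_of_mem_edges h)⟩)
  exact ⟨w, ⟨hwA, support_subset_of_isPath hT hB hxB hyB hpath w hw⟩, hwC⟩

/-- The Helly property: finitely many pairwise intersecting subtrees of a tree have a common
vertex. The given subtree `B` carries the induction, in which the other subtrees are added to it
one by one. -/
theorem helly_subtrees (hT : T.IsTree) {α : Type*} (s : Finset α) :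
    ∀ {A : α → Set ι} {B : Set ι}, (∀ a ∈ s, (T.induce (A a)).Preconnected) →
      (T.induce B).Preconnected → B.Nonempty → (∀ a ∈ s, (A a ∩ B).Nonempty) →
      (∀ a ∈ s, ∀ b ∈ s, (A a ∩ A b).Nonempty) → ∃ t ∈ B, ∀ a ∈ s, t ∈ A a := by
  classical
  induction s using Finset.induction_on with
  | empty =>
    rintro A B - - ⟨t, ht⟩ - -
    exact ⟨t, ht, by simp⟩
  | insert a s _ ih =>
    intro A B hA hB _ hAB hAA
    obtain ⟨t, ⟨hta, htB⟩, ht⟩ := ih (A := A) (B := A a ∩ B)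
      (fun b hb => hA b (Finset.mem_insert_of_mem hb))
      (preconnected_induce_inter hT (hA a (Finset.mem_insert_self a s)) hB)
      (hAB a (Finset.mem_insert_self a s))
      (fun b hb => by
        have hb' : b ∈ insert a s := Finset.mem_insert_of_mem hb
        have ha' := Finset.mem_insert_self a s
        rw [← Set.inter_assoc]
        exact inter_three_nonempty hT (hA b hb') (hA a ha') hB (hAA b hb' a ha') (hAB a ha')
          (hAB b hb'))
      (fun b hb b' hb' => hAA b (Finset.mem_insert_of_mem hb) b' (Finset.mem_insert_of_mem hb'))
    refine ⟨t, htB, fun b hb => ?_⟩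
    rcases Finset.mem_insert.1 hb with rfl | hb
    · exact hta
    · exact ht b hb

end Tree

/-! ### Treewidth and complete minors -/

/-- The nodes whose bags meet a connected vertex set `X` form a subtree. -/
theorem TreeDecomposition.preconnected_of_connected {V : Type u} {G : SimpleGraph V} {ι : Type v}
    {T : SimpleGraph ι} (D : TreeDecomposition G T) {X : Set V} (hX : (G.induce X).Preconnected) :
    (T.induce {t | (D.bag t ∩ X).Nonempty}).Preconnected := by
  have same : ∀ x ∈ X, ∀ t t', x ∈ D.bag t → x ∈ D.bag t' →
      ∃ p : T.Walk t t', ∀ z ∈ p.support, (D.bag z ∩ X).Nonempty := by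
    intro x hx t t' ht ht'
    obtain ⟨p, hp⟩ := exists_walk_of_preconnected_induce (D.connected x).preconnected ht ht'
    exact ⟨p, fun z hz => ⟨x, hp z hz, hx⟩⟩
  have key : ∀ {x y : V} (p : G.Walk x y), (∀ z ∈ p.support, z ∈ X) → ∀ t t', x ∈ D.bag t →
      y ∈ D.bag t' → ∃ q : T.Walk t t', ∀ z ∈ q.support, (D.bag z ∩ X).Nonempty := by
    intro x y p
    induction p with
    | nil => exact fun h t t' ht ht' => same _ (h _ (by simp)) t t' ht ht'
    | @cons x x' y hadj p ih =>
      intro h t t' ht ht'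
      obtain ⟨t₁, h₁, h₁'⟩ := D.edge_mem x x' hadj
      obtain ⟨q, hq⟩ := same x (h x (by simp)) t t₁ ht h₁
      obtain ⟨r, hr⟩ := ih (fun z hz => h z (by simp [hz])) t₁ t' h₁' ht'
      refine ⟨q.append r, fun z hz => ?_⟩
      rw [SimpleGraph.Walk.mem_support_append_iff] at hz
      exact hz.elim (hq z) (hr z)
  rintro ⟨t, x, hxt, hx⟩ ⟨t', y, hyt, hy⟩
  obtain ⟨p, hp⟩ := exists_walk_of_preconnected_induce hX hx hy
  obtain ⟨q, hq⟩ := key p hp t t' hxt hyt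
  exact ⟨q.induce _ hq⟩

/-- Some bag meets all of finitely many connected vertex sets that are pairwise adjacent. -/
theorem TreeDecomposition.exists_bag_meets {V : Type u} {G : SimpleGraph V} {ι : Type v}
    {T : SimpleGraph ι} (D : TreeDecomposition G T) {m : ℕ} {X : Fin m → Set V}
    (hX : ∀ a, (G.induce (X a)).Connected)
    (hadj : ∀ a b, a ≠ b → ∃ x ∈ X a, ∃ y ∈ X b, G.Adj x y) :
    ∃ t, ∀ a, (D.bag t ∩ X a).Nonempty := by
  have hT := D.isTree
  have huniv : (T.induce Set.univ).Preconnected := by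
    rintro ⟨x, -⟩ ⟨y, -⟩
    obtain ⟨p⟩ := hT.connected.preconnected x y
    exact ⟨p.induce _ fun _ _ => trivial⟩
  have hself : ∀ a, {t | (D.bag t ∩ X a).Nonempty}.Nonempty := by
    intro a
    obtain ⟨⟨x, hx⟩⟩ := (hX a).nonempty
    obtain ⟨⟨t, ht⟩⟩ := (D.connected x).nonempty
    exact ⟨t, x, ht, hx⟩
  obtain ⟨t, -, ht⟩ := helly_subtrees hT (Finset.univ : Finset (Fin m))
    (A := fun a => {t | (D.bag t ∩ X a).Nonempty}) (B := Set.univ)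
    (fun a _ => D.preconnected_of_connected (hX a).preconnected) huniv
    (have := hT.connected.nonempty; Set.univ_nonempty)
    (fun a _ => by simpa using hself a)
    (fun a _ b _ => by
      by_cases hab : a = b
      · subst hab
        simpa using hself a
      · obtain ⟨x, hx, y, hy, hxy⟩ := hadj a b hab
        obtain ⟨t, hxt, hyt⟩ := D.edge_mem x y hxy
        exact ⟨t, ⟨x, hxt, hx⟩, y, hyt, hy⟩)
  exact ⟨t, fun a => ht a (Finset.mem_univ a)⟩

theorem le_treewidth_of_isMinor_completeGraph {V : Type u} {G : SimpleGraph V} {m : ℕ}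
    (h : IsMinor (⊤ : SimpleGraph (Fin m)) G) : ((m - 1 : ℕ) : ℕ∞) ≤ treewidth G := by
  obtain ⟨X, hX, hdisj, hadj⟩ := h
  refine le_sInf ?_
  rintro _ ⟨ι, T, D, rfl⟩
  obtain ⟨t, ht⟩ := D.exists_bag_meets hX (fun a b hab => hadj a b hab)
  choose x hx using ht
  have hinj : Function.Injective x := by
    intro a b hab
    by_contra hne
    exact Set.disjoint_left.1 (hdisj a b hne) (hx a).2 (hab ▸ (hx b).2)
  have hbag : (m : ℕ∞) ≤ (D.bag t).encard := by
    calc (m : ℕ∞) = (Set.range x).encard := by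
          rw [← Set.image_univ, hinj.encard_image, Set.encard_univ]
          simp
      _ ≤ (D.bag t).encard := Set.encard_le_encard (by rintro _ ⟨a, rfl⟩; exact (hx a).1)
  calc ((m - 1 : ℕ) : ℕ∞) = (m : ℕ∞) - 1 := by simp
    _ ≤ D.width := tsub_le_tsub_right (hbag.trans (le_iSup (fun t => (D.bag t).encard) t)) 1

end CliquewidthQI

theorem theorem2 (c : ℝ) (hc : 1 ≤ c) (k : ℕ) (hk : 6 ≤ k) :
    ∃ n : ℕ, 4 * c * (c + 1) - 1 ≤ (n : ℝ) ∧
      CliquewidthQI.cliquewidth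
          (CliquewidthQI.subdivision (⊤ : SimpleGraph (Fin (k - 2))) n) ≤ (k : ℕ∞) ∧
      (∀ (W : Type u) (G' : SimpleGraph W),
        CliquewidthQI.QIEmbeddable c
            (CliquewidthQI.subdivision (⊤ : SimpleGraph (Fin (k - 2))) n) G' →
          CliquewidthQI.IsMinor (⊤ : SimpleGraph (Fin (k - 2))) G') ∧
      (∀ (W : Type u) (G' : SimpleGraph W),
        CliquewidthQI.treewidth G' < ((k - 3 : ℕ) : ℕ∞) →
          ¬ CliquewidthQI.QuasiIsometric c
            (CliquewidthQI.subdivision (⊤ : SimpleGraph (Fin (k - 2))) n) G') := by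
  obtain ⟨m, rfl⟩ := Nat.exists_eq_add_of_le' (show 2 ≤ k by omega)
  rw [show m + 2 - 2 = m by omega, show m + 2 - 3 = m - 1 by omega]
  obtain ⟨d, hd⟩ := exists_nat_ge (8 * c * (c + 1))
  have hd1 : 1 ≤ d := by
    have : (0 : ℝ) < d := lt_of_lt_of_le (by positivity) hd
    exact_mod_cast this
  have hminor : ∀ (W : Type u) (G' : SimpleGraph W),
      CliquewidthQI.QIEmbeddable c
          (CliquewidthQI.subdivision (⊤ : SimpleGraph (Fin m)) (3 * d)) G' →
        CliquewidthQI.IsMinor (⊤ : SimpleGraph (Fin m)) G' :=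
    fun W G' h => CliquewidthQI.isMinor_of_qiEmbeddable hc hd le_rfl h
  refine ⟨3 * d, ?_,
    CliquewidthQI.cliquewidth_subdivision_completeGraph_le (by omega) (by omega), hminor, ?_⟩
  · push_cast
    nlinarith
  · rintro W G' htw ⟨f, hf, -⟩
    exact htw.not_ge (CliquewidthQI.le_treewidth_of_isMinor_completeGraph (hminor W G' ⟨f, hf⟩))
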